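/- **Witness Tree Lemma.** Let $N\ge 0$ and $n_1,\dots,n_N\ge 0$ be integers. A *bad-event* is a finite set $B$ of triples $(k,x,y)$ with $1\le k\le N$ and $x,y\in[n_k]$; it is *true* for permutations $\pi=(\pi_1,\dots,\pi_N)$, $\pi_k$ a permutation of $[n_k]$, if $\pi_k(x)=y$ for all $(k,x,y)\in B$. Write $B\sim B'$ if there are $(k,x,y)\in B$ and $(k,x',y')\in B'$ with $x=x'$ or $y=y'$. Let $P_\Omega(B)$ be the probability that $B$ is true when $\pi_1,\dots,\pi_N$ are uniform and independent. Let $\mathcal B$ be a set of bad-events. The *Swapping Algorithm* draws $\pi^0_1,\dots,\pi^0_N$ uniformly and independently. At time $t=0,1,2,\dots$, if no $B\in\mathcal B$ is true for $\pi^t$ it stops; otherwise a true $B\in\mathcal B$ is chosen arbitrarily (possibly depending on the whole past and on additional randomness, but not on future swaps) and resampled: independently for each $k$, $\pi_k^{t+1}=\mathrm{Swap}(\pi_k^t;x_1,\dots,x_r)$, where $x_1,\dots,x_r$ are, in some order, the distinct $x$ for which $B$ contains a triple $(k,x,y)$. Here $\mathrm{Swap}(\pi;x_1,\dots,x_r)$,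 for a permutation $\pi$ of $[n]$, does the following for $i=1,\dots,r$: select $x_i'$ uniformly at random in $[n]\setminus\{x_1,\dots,x_{i-1}\}$ and exchange the entries $x_i$ and $x_i'$ of $\pi$. If $B^{(0)},\dots,B^{(T)}$ are the bad-events resampled at times $0,\dots,T$, the *witness tree* $\hat\tau^T$ is the rooted labeled tree built as follows. Start with a root labeled $B^{(T)}$. For $t=T-1,\dots,0$: if some node of the current tree has a label $B'$ with $B^{(t)}\sim B'$, attach a new leaf labeled $B^{(t)}$ as a child of such a node of maximum depth (ties broken arbitrarily); otherwise ignore $B^{(t)}$. Let $\tau$ be a finite rooted tree with $s$ nodes, labeled by bad-events $B_1,\dots,B_s$. Then $$P\big(\hat\tau^T=\tau \text{ for some } T\ge 0 \text{ and some way of breaking ties}\big)\le P_\Omega(B_1)\cdots P_\Omega(B_s).$$ Moreover, if a bad-event $B$ has $r_k$ triples belonging to permutation $k$ for each $k$, and contains no two triples $(k,x,y),(k,x,y')$ with $y\ne y'$ nor $(k,x,y),(k,x',y)$ with $x\neq x'$, then $$P_\Omega(B)=\prod_{k=1}^N\frac{(n_k-r_k)!}{n_k!}.$$ -/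

import Mathlib

open MeasureTheory

namespace SwapLLL

/-- A triple `⟨k, x, y⟩`, standing for the condition `π k x = y`. -/
abbrev Triple {N : ℕ} (n : Fin N → ℕ) : Type :=
  Σ k : Fin N, Fin (n k) × Fin (n k)

/-- An atomic bad-event: a finite set of triples, i.e. a conjunction of conditions `π k x = y`. -/
abbrev BadEvent {N : ℕ} (n : Fin N → ℕ) : Type :=
  Finset (Triple n)

/-- A configuration: one permutation of an `n k`-element set for every `k`. -/
abbrev Config {N : ℕ} (n : Fin N → ℕ) : Type :=
  (k : Fin N) → Equiv.Perm (Fin (n k))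

section Events

variable {N : ℕ} {n : Fin N → ℕ}

/-- `B` is true in the configuration `p`. -/
def Holds (B : BadEvent n) (p : Config n) : Prop :=
  ∀ b ∈ B, p b.1 b.2.1 = b.2.2

/-- `B` has no two triples `(k,x,y), (k,x,y')` with `y ≠ y'`, nor `(k,x,y), (k,x',y)` with
`x ≠ x'`. -/
def Consistent (B : BadEvent n) : Prop :=
  (∀ (k : Fin N) (x y y' : Fin (n k)), ⟨k, x, y⟩ ∈ B → ⟨k, x, y'⟩ ∈ B → y = y') ∧
  (∀ (k : Fin N) (x x' y : Fin (n k)), ⟨k, x, y⟩ ∈ B → ⟨k, x', y⟩ ∈ B → x = x')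

/-- The dependency relation `B ∼ B'`: the two events overlap in a slice of the domain or of the
range of some permutation. -/
def Dep (B B' : BadEvent n) : Prop :=
  ∃ (k : Fin N) (x y x' y' : Fin (n k)),
    ⟨k, x, y⟩ ∈ B ∧ ⟨k, x', y'⟩ ∈ B' ∧ (x = x' ∨ y = y')

/-- The number of triples of `B` that concern permutation `k`. -/
def countAt (B : BadEvent n) (k : Fin N) : ℕ :=
  (B.filter fun b => b.1 = k).card

/-- The set of all `x` such that `B` has a triple `(k,x,*)`. -/
def entries (B : BadEvent n) (k : Fin N) : Finset (Fin (n k)) :=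
  Finset.univ.filter fun x => ∃ y, (⟨k, x, y⟩ : Triple n) ∈ B

open Classical in
/-- The probability of `B` when all the permutations are uniform and independent, i.e. when the
configuration is uniformly distributed. -/
noncomputable def probOmega (B : BadEvent n) : ℝ :=
  ((Finset.univ.filter fun p : Config n => Holds B p).card : ℝ) / (Fintype.card (Config n) : ℝ)

end Events

/-- The loop of the swapping subroutine; `used` is the set of the `x_j` that were handled already.
For the next entry `x`, an `x'` is picked uniformly outside `used`, and the entries `x` and `x'`
of `p` are exchanged. (For a list without repetitions that avoids `used`, the last branch is never
reached.) -/
noncomputable def swapLoop {m : ℕ} :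
    Finset (Fin m) → List (Fin m) → Equiv.Perm (Fin m) → PMF (Equiv.Perm (Fin m))
  | _, [], p => PMF.pure p
  | used, x :: xs, p =>
      if h : (Finset.univ \ used).Nonempty then
        (PMF.uniformOfFinset (Finset.univ \ used) h).bind fun x' =>
          swapLoop (insert x used) xs (p * Equiv.swap x x')
      else PMF.pure p

/-- The distribution of `Swap(p; x_1, …, x_r)`. -/
noncomputable def swapLaw {m : ℕ} (xs : List (Fin m)) (p : Equiv.Perm (Fin m)) :
    PMF (Equiv.Perm (Fin m)) :=
  swapLoop ∅ xs p

/-- `conf t` and `ev t` (for `t = 0, 1, 2, …`) describe a run of the Swapping Algorithm for the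
family `𝓑` of bad-events: `conf t ω` is the configuration at time `t`, and `ev t ω` is the
bad-event resampled in the iteration leading from time `t` to time `t + 1`, or `none` if the
algorithm has terminated by time `t`. The choice of the true bad-event to be resampled is
arbitrary: it may depend on the whole past and on extra randomness, but not on the future swaps. -/
structure IsSwappingRun {N : ℕ} {n : Fin N → ℕ} (𝓑 : Set (BadEvent n))
    {Ω : Type*} [MeasurableSpace Ω] (P : Measure Ω)
    (conf : ℕ → Ω → Config n) (ev : ℕ → Ω → Option (BadEvent n)) : Prop where
  measurableSet_conf : ∀ t p, MeasurableSet {ω | conf t ω = p}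
  measurableSet_ev : ∀ t b, MeasurableSet {ω | ev t ω = b}
  /-- The initial permutations are uniform and independent. -/
  initial : ∀ p, P {ω | conf 0 ω = p} = PMF.uniformOfFintype (Config n) p
  /-- Only true bad-events are resampled. -/
  chosen : ∀ᵐ ω ∂P, ∀ t B, ev t ω = some B → B ∈ 𝓑 ∧ Holds B (conf t ω)
  /-- The algorithm stops only if no bad-event is true. -/
  stopped : ∀ᵐ ω ∂P, ∀ t, ev t ω = none →
    (∀ B ∈ 𝓑, ¬ Holds B (conf t ω)) ∧ conf (t + 1) ω = conf t ω
  /-- Given the past and the choice of `B` at time `t`, every permutation `k` undergoes,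
  independently of the others, the swapping of the entries `x` with `(k,x,*) ∈ B`, taken in some
  order. -/
  resample : ∀ (t : ℕ) (p : ℕ → Config n) (b : ℕ → Option (BadEvent n)) (B : BadEvent n),
    b t = some B →
    ∃ xs : (k : Fin N) → List (Fin (n k)),
      (∀ k, (xs k).Nodup ∧ (xs k).toFinset = entries B k) ∧
      ∀ p' : Config n,
        P {ω | (∀ s ≤ t, conf s ω = p s ∧ ev s ω = b s) ∧ conf (t + 1) ω = p'} =
          P {ω | ∀ s ≤ t, conf s ω = p s ∧ ev s ω = b s} *
            ∏ k, swapLaw (xs k) (p t k) (p' k)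

/-- Finite rooted trees with nodes labeled in `α`. -/
inductive WitnessTree (α : Type) : Type
  | node (a : α) (children : List (WitnessTree α)) : WitnessTree α

namespace WitnessTree

variable {α : Type}

mutual

/-- The list of the labels of all nodes, with multiplicity. -/
def labels : WitnessTree α → List α
  | node a ts => a :: forestLabels ts

/-- The list of the labels of all nodes of a list of trees. -/
def forestLabels : List (WitnessTree α) → List α
  | [] => []
  | t :: ts => labels t ++ forestLabels ts

end

/-- `HasNode t d a`: the tree `t` has a node of depth `d` labeled `a`. -/
inductive HasNode : WitnessTree α → ℕ → α → Prop
  | root (a : α) (ts : List (WitnessTree α)) : HasNode (node a ts) 0 a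
  | child (a : α) (ts : List (WitnessTree α)) (t : WitnessTree α) (d : ℕ) (b : α) :
      t ∈ ts → HasNode t d b → HasNode (node a ts) (d + 1) b

/-- `AddLeaf b d a t t'`: the tree `t'` arises from `t` by attaching a new leaf labeled `b` to some
node of depth `d` labeled `a`. The new leaf may be put anywhere among its siblings, so that the
order of siblings is immaterial. -/
inductive AddLeaf (b : α) : ℕ → α → WitnessTree α → WitnessTree α → Prop
  | here (a : α) (l r : List (WitnessTree α)) :
      AddLeaf b 0 a (node a (l ++ r)) (node a (l ++ node b [] :: r))
  | deeper (c : α) (l r : List (WitnessTree α)) (d : ℕ) (a : α) (t t' : WitnessTree α) :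
      AddLeaf b d a t t' →
      AddLeaf b (d + 1) a (node c (l ++ t :: r)) (node c (l ++ t' :: r))

/-- One step of the backward construction with respect to the relation `rel`: the event `b` becomes
a child of a deepest node whose label is related to `b` (any one of them), and `b` is ignored if
there is no such node. -/
inductive BackStep (rel : α → α → Prop) (b : α) : WitnessTree α → WitnessTree α → Prop
  | attach (d : ℕ) (a : α) (t t' : WitnessTree α) :
      AddLeaf b d a t t' → rel b a →
      (∀ d' a', HasNode t d' a' → rel b a' → d' ≤ d) → BackStep rel b t t'
  | ignore (t : WitnessTree α) :
      (∀ d a, HasNode t d a → ¬ rel b a) → BackStep rel b t t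

/-- `IsBuiltFrom rel l t`: for the execution log `l` (in chronological order), `t` is the witness
tree of the last entry of `l`, for some way of breaking the ties. -/
inductive IsBuiltFrom (rel : α → α → Prop) : List α → WitnessTree α → Prop
  | start (b : α) : IsBuiltFrom rel [b] (node b [])
  | back (b : α) (l : List α) (t t' : WitnessTree α) :
      IsBuiltFrom rel l t → BackStep rel b t t' → IsBuiltFrom rel (b :: l) t'

end WitnessTree

/-- `τ` appears, given the sequence `e` of resampled bad-events: for some `T`, an event is
resampled at time `T` (and at all earlier times), and `τ` is its witness tree. -/
def Appears {N : ℕ} {n : Fin N → ℕ} (τ : WitnessTree (BadEvent n))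
    (e : ℕ → Option (BadEvent n)) : Prop :=
  ∃ (T : ℕ) (l : List (BadEvent n)),
    (List.range (T + 1)).map e = l.map some ∧ WitnessTree.IsBuiltFrom Dep l τ

end SwapLLL

-- Resampling `B` where `B` is true is a nonnegative matrix `eventMatrix B` on configurations. Two
-- facts carry the theorem: every column sums to P_Ω(B) (`sum_eventMatrix_mul`), and the matrices of
-- unrelated events commute (`eventMatrix_commute`).
--
-- Both come from a factorization. Up to a constant, resampling a consistent `B` is a product of
-- matrices `pointMatrix`, one per triple, each of which checks π(x) = y and then swaps x with an
-- unrestricted partner. The checks that follow a swap do the work of excluding entries as partners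
-- (`prod_pointMatrix_apply`); this rests on the order independence of Swap.
--
-- Give τ the product `levelProd` of the matrices of its labels, deepest level first. Given the past
-- and the present configuration p, the probability that τ appears in the log starting now is at
-- most the row sum at p (`IsSwappingRun.appearanceBound`). Induct on the number of events
-- inspected: the first event B of the log is the last one treated by the backward construction. If
-- it was attached, the tree before it is determined by τ and B (`BackStep.unique`), and since
-- nothing at the level of the new leaf or below was related to B, its matrix commutes to the front
-- (`AddLeaf.levelProd_eq`). If it was ignored, its matrix commutes to the back, where its row sums
-- are at most 1. Averaging the bound over a uniform initial configuration turns row sums into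
-- column sums, hence into ∏ P_Ω(B_i).

open scoped ENNReal

namespace SwapLLL

-- Swaps in one permutation: order independence and factorization

section SinglePermutation

variable {m : ℕ}

/-- The matrix that multiplies a permutation on the right by all transpositions `(x a)` with
`a ∉ U`. -/
noncomputable def swapSum (U : Finset (Fin m)) (x : Fin m) :
    Matrix (Equiv.Perm (Fin m)) (Equiv.Perm (Fin m)) ℝ≥0∞ :=
  fun p q => ∑ a ∈ Finset.univ \ U, if p * Equiv.swap x a = q then 1 else 0

lemma swapSum_mul_apply (U : Finset (Fin m)) (x : Fin m)
    (X : Matrix (Equiv.Perm (Fin m)) (Equiv.Perm (Fin m)) ℝ≥0∞) (p q : Equiv.Perm (Fin m)) :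
    (swapSum U x * X) p q = ∑ a ∈ Finset.univ \ U, X (p * Equiv.swap x a) q := by
  simp only [Matrix.mul_apply, swapSum, Finset.sum_mul]
  rw [Finset.sum_comm]
  simp

lemma swapSum_mul_swapSum_apply (U V : Finset (Fin m)) (x z : Fin m)
    (p q : Equiv.Perm (Fin m)) :
    (swapSum U x * swapSum V z) p q =
      ∑ c ∈ (Finset.univ \ U) ×ˢ (Finset.univ \ V),
        if p * (Equiv.swap x c.1 * Equiv.swap z c.2) = q then 1 else 0 := by
  rw [swapSum_mul_apply, Finset.sum_product]
  simp only [swapSum, mul_assoc]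

lemma swap_mul_swap_of_ne {x z a b : Fin m} (hxz : x ≠ z) (ha : a ≠ z) (hb : b ≠ x)
    (hab : a ≠ b) :
    Equiv.swap x a * Equiv.swap z b = Equiv.swap z b * Equiv.swap x a := by
  ext i
  simp only [Equiv.Perm.mul_apply, Equiv.swap_apply_def]
  grind

lemma swap_mul_swap_middle {x z b : Fin m} (hxz : x ≠ z) (hb : b ≠ x) :
    Equiv.swap x z * Equiv.swap z b = Equiv.swap z b * Equiv.swap x b := by
  ext i
  simp only [Equiv.Perm.mul_apply, Equiv.swap_apply_def]
  grind

lemma swap_mul_swap_left {x z a : Fin m} (hxz : x ≠ z) (ha : a ≠ z) :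
    Equiv.swap x a * Equiv.swap z x = Equiv.swap z a * Equiv.swap x a := by
  simpa [mul_inv_rev] using congrArg (·⁻¹) (swap_mul_swap_middle hxz.symm ha)

/-- The reindexing of pairs of transpositions underlying the order independence of two swaps. -/
def exchangePair (x z : Fin m) (c : Fin m × Fin m) : Fin m × Fin m :=
  if c.1 = z then (if c.2 = z then (x, x) else (c.2, c.2))
  else if c.1 = c.2 then (x, c.1) else (c.2, c.1)

lemma exchangePair_mem {U : Finset (Fin m)} {x z : Fin m} (hx : x ∉ U)
    {c : Fin m × Fin m}
    (h : c ∈ (Finset.univ \ U) ×ˢ (Finset.univ \ insert x U)) :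
    exchangePair x z c ∈ (Finset.univ \ U) ×ˢ (Finset.univ \ insert z U) := by
  obtain ⟨a, b⟩ := c
  simp only [Finset.mem_product, Finset.mem_sdiff, Finset.mem_univ, true_and,
    Finset.mem_insert, exchangePair] at h ⊢
  split_ifs <;> grind

lemma exchangePair_exchangePair {U : Finset (Fin m)} {x z : Fin m}
    {c : Fin m × Fin m}
    (h : c ∈ (Finset.univ \ U) ×ˢ (Finset.univ \ insert x U)) :
    exchangePair z x (exchangePair x z c) = c := by
  obtain ⟨a, b⟩ := c
  simp only [Finset.mem_product, Finset.mem_sdiff, Finset.mem_univ, true_and,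
    Finset.mem_insert, exchangePair] at h ⊢
  split_ifs <;> grind

/-- `exchangePair` matches pairs of transpositions with equal products: disjoint ones commute, and
overlapping ones are rewritten inside the symmetric group on the entries involved. -/
lemma swapSum_exchange {U : Finset (Fin m)} {x z : Fin m} (hxz : x ≠ z) (hx : x ∉ U)
    (hz : z ∉ U) :
    swapSum U x * swapSum (insert x U) z = swapSum U z * swapSum (insert z U) x := by
  ext p q
  rw [swapSum_mul_swapSum_apply, swapSum_mul_swapSum_apply]
  refine Finset.sum_bij' (fun c _ => exchangePair x z c) (fun c _ => exchangePair z x c)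
    (fun c h => exchangePair_mem hx h) (fun c h => exchangePair_mem hz h)
    (fun c h => exchangePair_exchangePair h)
    (fun c h => exchangePair_exchangePair h) ?_
  rintro ⟨a, b⟩ h
  simp only [Finset.mem_product, Finset.mem_sdiff, Finset.mem_univ, true_and,
    Finset.mem_insert, not_or] at h
  obtain ⟨ha, hbx, hb⟩ := h
  suffices Equiv.swap x a * Equiv.swap z b =
      Equiv.swap z (exchangePair x z (a, b)).1 * Equiv.swap x (exchangePair x z (a, b)).2 by
    rw [this]
  unfold exchangePair
  dsimp only
  split_ifs with h1 h2 h3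
  · subst h1 h2
    simp [Equiv.swap_comm]
  · subst h1
    exact swap_mul_swap_middle hxz hbx
  · subst h3
    exact (swap_mul_swap_middle hxz.symm h1).symm
  · exact swap_mul_swap_of_ne hxz h1 hbx h3

/-- Excluding `z` as a partner of `x` is what makes the reindexing bijective; `U ⊆ V` keeps the
reindexed partner of `z` admissible. -/
lemma swapSum_comm {U V : Finset (Fin m)} {x z : Fin m} (hUV : U ⊆ V) (hxz : x ≠ z)
    (hx : x ∉ V) :
    swapSum U z * swapSum (insert z V) x = swapSum (insert z V) x * swapSum U z := by
  ext p q
  rw [swapSum_mul_swapSum_apply, swapSum_mul_swapSum_apply]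
  refine Finset.sum_bij'
    (fun c _ => if c.1 = x then (if c.2 = x then (x, x) else (c.2, c.2))
      else if c.1 = c.2 then (c.1, x) else (c.2, c.1))
    (fun c _ => if c.2 = x then (if c.1 = x then (x, x) else (c.1, c.1))
      else if c.1 = c.2 then (x, c.1) else (c.2, c.1)) ?_ ?_ ?_ ?_ ?_
  · rintro ⟨a, b⟩ h
    simp only [Finset.mem_product, Finset.mem_sdiff, Finset.mem_univ, true_and,
      Finset.mem_insert] at h ⊢
    split_ifs <;> grind
  · rintro ⟨a, b⟩ h
    simp only [Finset.mem_product, Finset.mem_sdiff, Finset.mem_univ, true_and,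
      Finset.mem_insert] at h ⊢
    split_ifs <;> grind
  · rintro ⟨a, b⟩ h
    dsimp only
    split_ifs <;> grind
  · rintro ⟨a, b⟩ h
    dsimp only
    split_ifs <;> grind
  · rintro ⟨b, a⟩ h
    simp only [Finset.mem_product, Finset.mem_sdiff, Finset.mem_univ, true_and,
      Finset.mem_insert, not_or] at h
    obtain ⟨hb, haz, ha⟩ := h
    dsimp only
    suffices Equiv.swap z b * Equiv.swap x a =
        Equiv.swap x (if b = x then (if a = x then (x, x) else (a, a))
          else if b = a then (b, x) else (a, b)).1 *
        Equiv.swap z (if b = x then (if a = x then (x, x) else (a, a))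
          else if b = a then (b, x) else (a, b)).2 by
      rw [this]
    split_ifs with h1 h2 h3
    · subst h1 h2
      rw [Equiv.swap_self]
      rfl
    · subst h1
      exact swap_mul_swap_middle hxz.symm haz
    · subst h3
      exact (swap_mul_swap_left hxz haz).symm
    · exact (swap_mul_swap_of_ne hxz haz h1 (Ne.symm h3)).symm

/-- The unnormalized transition matrix of the swapping subroutine. -/
noncomputable def loopMatrix :
    Finset (Fin m) → List (Fin m) → Matrix (Equiv.Perm (Fin m)) (Equiv.Perm (Fin m)) ℝ≥0∞
  | _, [] => 1
  | U, x :: xs => swapSum U x * loopMatrix (insert x U) xs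

lemma loopMatrix_perm {xs ys : List (Fin m)} (h : xs.Perm ys) :
    ∀ (U : Finset (Fin m)), xs.Nodup → (∀ x ∈ xs, x ∉ U) →
      loopMatrix U xs = loopMatrix U ys := by
  induction h with
  | nil => intros; rfl
  | cons x h ih =>
    intro U hn hU
    rw [List.nodup_cons] at hn
    rw [loopMatrix, loopMatrix, ih _ hn.2]
    intro y hy
    have := hU y (List.mem_cons_of_mem _ hy)
    grind
  | swap x y l =>
    intro U hn hU
    simp only [loopMatrix, ← mul_assoc]
    rw [swapSum_exchange (by grind) (hU y (by simp)) (hU x (by simp)), Finset.insert_comm]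
  | trans h1 h2 ih1 ih2 =>
    intro U hn hU
    rw [ih1 U hn hU, ih2 U (h1.nodup_iff.mp hn) (fun x hx => hU x (h1.mem_iff.mpr hx))]

/-- It is immaterial whether later swaps avoid `x` or the swap of `x` avoids the later entries. Each
induction step exchanges `x` with the next entry, applies the hypothesis, and commutes `x` back to
the front. -/
lemma swapSum_mul_loopMatrix_insert (xs : List (Fin m)) :
    ∀ (U : Finset (Fin m)) (x : Fin m), (x :: xs).Nodup → (∀ y ∈ x :: xs, y ∉ U) →
      swapSum U x * loopMatrix (insert x U) xs =
        swapSum (U ∪ xs.toFinset) x * loopMatrix U xs := by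
  induction xs with
  | nil => intro U x _ _; simp [loopMatrix]
  | cons z xs ih =>
    intro U x hn hU
    have hxz : x ≠ z := by grind
    simp only [loopMatrix, ← mul_assoc]
    rw [swapSum_exchange hxz (hU x (by simp)) (hU z (by simp)), Finset.insert_comm, mul_assoc,
      ih _ _ (by grind) (by grind), ← mul_assoc]
    congr 1
    have : U ∪ (z :: xs).toFinset = insert z (U ∪ xs.toFinset) := by
      ext; simp
    rw [this, ← swapSum_comm (Finset.subset_union_left) hxz, Finset.insert_union]
    rw [Finset.mem_union, List.mem_toFinset]
    exact fun h => h.elim (hU x (by simp)) (by grind)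

/-- The unnormalized matrix of resampling a single condition `π x = y`. -/
noncomputable def pointMatrix (t : Fin m × Fin m) :
    Matrix (Equiv.Perm (Fin m)) (Equiv.Perm (Fin m)) ℝ≥0∞ :=
  fun p q => if p t.1 = t.2 then swapSum ∅ t.1 p q else 0

lemma pointMatrix_mul_apply (t : Fin m × Fin m)
    (X : Matrix (Equiv.Perm (Fin m)) (Equiv.Perm (Fin m)) ℝ≥0∞) (p q : Equiv.Perm (Fin m)) :
    (pointMatrix t * X) p q = if p t.1 = t.2 then (swapSum ∅ t.1 * X) p q else 0 := by
  simp only [Matrix.mul_apply, pointMatrix]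
  split_ifs <;> simp

/-- After `x` is swapped with an arbitrary partner, the remaining checks pass only if that partner
is none of their entries. The exclusions of Swap are thus enforced by the checks. -/
lemma prod_pointMatrix_apply (L : List (Fin m × Fin m)) (h1 : (L.map Prod.fst).Nodup)
    (h2 : (L.map Prod.snd).Nodup) (p q : Equiv.Perm (Fin m)) :
    (L.map pointMatrix).prod p q =
      if ∀ t ∈ L, p t.1 = t.2 then loopMatrix ∅ (L.map Prod.fst) p q else 0 := by
  induction L generalizing p with
  | nil => simp [loopMatrix]
  | cons s L ih =>
    obtain ⟨x, y⟩ := s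
    simp only [List.map_cons, List.nodup_cons] at h1 h2
    -- Move the exclusion from the later swaps to the swap of `x`, so that the tail has the form in
    -- the induction hypothesis.
    have key : loopMatrix ∅ (List.map Prod.fst ((x, y) :: L)) =
        swapSum (∅ ∪ (L.map Prod.fst).toFinset) x * loopMatrix ∅ (L.map Prod.fst) := by
      rw [List.map_cons, loopMatrix, swapSum_mul_loopMatrix_insert]
      · simpa using h1
      · simp
    rw [List.map_cons, List.prod_cons, pointMatrix_mul_apply, key, swapSum_mul_apply,
      swapSum_mul_apply]
    simp only [ih h1.2 h2.2, List.forall_mem_cons, ite_and]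
    by_cases hxy : p x = y
    swap
    · rw [if_neg hxy, if_neg hxy]
    rw [if_pos hxy, if_pos hxy]
    split_ifs with hL
    · rw [← Finset.sum_filter]
      refine Finset.sum_congr ?_ fun _ _ => rfl
      ext a
      rw [Finset.mem_filter, Finset.sdiff_empty]
      simp only [Finset.mem_sdiff, Finset.mem_univ, true_and, Finset.empty_union,
        List.mem_toFinset, List.mem_map, Equiv.Perm.mul_apply]
      constructor
      · rintro h ⟨t, ht, rfl⟩
        have := h t ht
        rw [Equiv.swap_apply_right, hxy] at this
        exact h2.1 (List.mem_map.mpr ⟨t, ht, this.symm⟩)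
      · intro h t ht
        rw [Equiv.swap_apply_of_ne_of_ne, hL t ht]
        · rintro rfl
          exact h1.1 (List.mem_map.mpr ⟨t, ht, rfl⟩)
        · rintro rfl
          exact h ⟨t, ht, rfl⟩
    -- The swap cannot repair a failed condition: it either leaves that entry alone or puts there
    -- the value `y`, which no other condition asks for.
    · refine Finset.sum_eq_zero fun a _ => if_neg fun h => hL fun t ht => ?_
      have := h t ht
      by_cases hta : t.1 = a
      · subst hta
        rw [Equiv.Perm.mul_apply, Equiv.swap_apply_right, hxy] at this
        exact (h2.1 (List.mem_map.mpr ⟨t, ht, this.symm⟩)).elim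
      · rwa [Equiv.Perm.mul_apply, Equiv.swap_apply_of_ne_of_ne _ hta] at this
        rintro rfl
        exact h1.1 (List.mem_map.mpr ⟨t, ht, rfl⟩)

/-- Either product is Swap of the same two entries, restricted by the same two conditions, and Swap
does not depend on the order. -/
lemma pointMatrix_commute {s t : Fin m × Fin m} (h1 : s.1 ≠ t.1) (h2 : s.2 ≠ t.2) :
    Commute (pointMatrix s) (pointMatrix t) := by
  ext p q
  have h := prod_pointMatrix_apply [s, t] (by simpa) (by simpa) p q
  have h' := prod_pointMatrix_apply [t, s] (by simpa using h1.symm) (by simpa using h2.symm) p q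
  simp only [List.map_cons, List.map_nil, List.prod_cons, List.prod_nil, mul_one] at h h'
  rw [h, h', loopMatrix_perm (List.Perm.swap _ _ _) ∅ (by simpa) (by simp)]
  simp [and_comm]

/-- The partner `a` determines the predecessor of `q`, and this predecessor satisfies the condition
exactly when `q a = t.2`, so exactly one `a` contributes. -/
lemma sum_pointMatrix (t : Fin m × Fin m) (q : Equiv.Perm (Fin m)) :
    ∑ p, pointMatrix t p q = 1 := by
  simp only [pointMatrix, swapSum]
  calc _ = ∑ p : Equiv.Perm (Fin m), ∑ a, if p * Equiv.swap t.1 a = q then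
        (if q a = t.2 then (1 : ℝ≥0∞) else 0) else 0 := by
        refine Finset.sum_congr rfl fun p _ => ?_
        rw [Finset.sdiff_empty]
        by_cases hp : p t.1 = t.2
        · rw [if_pos hp]
          refine Finset.sum_congr rfl fun a _ => ?_
          split_ifs with h h'
          · rfl
          · subst h; simp [hp] at h'
          · rfl
        · rw [if_neg hp]
          refine (Finset.sum_eq_zero fun a _ => ?_).symm
          split_ifs with h h'
          · subst h; simp [hp] at h'
          · rfl
          · rfl
    _ = 1 := by
        rw [Finset.sum_comm]
        simp only [← eq_mul_inv_iff_mul_eq, Finset.sum_ite_eq', Finset.mem_univ, if_true]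
        simp [← Equiv.eq_symm_apply]

lemma sum_prod_pointMatrix (L : List (Fin m × Fin m)) (q : Equiv.Perm (Fin m)) :
    ∑ p, (L.map pointMatrix).prod p q = 1 := by
  induction L generalizing q with
  | nil => simp [Matrix.one_apply]
  | cons s L ih =>
    simp only [List.map_cons, List.prod_cons, Matrix.mul_apply]
    rw [Finset.sum_comm]
    simp only [← Finset.sum_mul, sum_pointMatrix, one_mul, ih]

lemma swapLoop_apply (xs : List (Fin m)) : ∀ (U : Finset (Fin m)), xs.Nodup → (∀ x ∈ xs, x ∉ U) →
    ∀ p q : Equiv.Perm (Fin m), swapLoop U xs p q =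
      (((m - U.card).descFactorial xs.length : ℕ) : ℝ≥0∞)⁻¹ * loopMatrix U xs p q := by
  induction xs with
  | nil =>
    intro U _ _ p q
    simp [swapLoop, loopMatrix, Matrix.one_apply, PMF.pure_apply, eq_comm]
  | cons x xs ih =>
    intro U hn hU p q
    have hne : (Finset.univ \ U).Nonempty := ⟨x, by simpa using hU x (by simp)⟩
    have hcard : (Finset.univ \ U).card = m - U.card := by
      rw [Finset.card_sdiff_of_subset (Finset.subset_univ _)]; simp
    have hpos : 0 < m - U.card := by rw [← hcard]; exact hne.card_pos
    obtain ⟨r, hr⟩ : ∃ r, m - U.card = r + 1 := ⟨m - U.card - 1, by omega⟩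
    have hr' : m - (insert x U).card = r := by
      rw [Finset.card_insert_of_notMem (hU x (by simp))]; omega
    rw [swapLoop, dif_pos hne, PMF.bind_apply, tsum_fintype, loopMatrix, swapSum_mul_apply,
      Finset.mul_sum, ← Finset.sum_subset (Finset.subset_univ (Finset.univ \ U))]
    · refine Finset.sum_congr rfl fun a ha => ?_
      rw [PMF.uniformOfFinset_apply_of_mem _ ha, ih _ (by grind) (by grind), hcard, hr, hr',
        ← mul_assoc, List.length_cons, Nat.succ_descFactorial_succ, Nat.cast_mul,
        ENNReal.mul_inv (Or.inr (ENNReal.natCast_ne_top _)) (Or.inl (ENNReal.natCast_ne_top _))]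
    · intro a _ ha
      rw [PMF.uniformOfFinset_apply_of_notMem _ ha, zero_mul]

end SinglePermutation

-- Transition matrices of bad-events: commutation and column sums

section Configurations

variable {N : ℕ} {n : Fin N → ℕ}

/-- The tensor product of a family of matrices, one for each permutation. -/
noncomputable def tensor
    (K : (k : Fin N) → Matrix (Equiv.Perm (Fin (n k))) (Equiv.Perm (Fin (n k))) ℝ≥0∞) :
    Matrix (Config n) (Config n) ℝ≥0∞ :=
  fun p q => ∏ k, K k (p k) (q k)

lemma tensor_mul
    (K K' : (k : Fin N) → Matrix (Equiv.Perm (Fin (n k))) (Equiv.Perm (Fin (n k))) ℝ≥0∞) :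
    tensor K * tensor K' = tensor fun k => K k * K' k := by
  ext p q
  simp only [Matrix.mul_apply, tensor, ← Finset.prod_mul_distrib]
  exact (Fintype.prod_sum fun k r => K k (p k) r * K' k r (q k)).symm

lemma sum_tensor
    (K : (k : Fin N) → Matrix (Equiv.Perm (Fin (n k))) (Equiv.Perm (Fin (n k))) ℝ≥0∞)
    (q : Config n) : ∑ p, tensor K p q = ∏ k, ∑ p, K k p (q k) :=
  (Fintype.prod_sum fun k r => K k r (q k)).symm

/-- The conditions that `B` imposes on the permutation `k`. -/
noncomputable def slice (B : BadEvent n) (k : Fin N) : List (Fin (n k) × Fin (n k)) :=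
  (Finset.univ.filter fun t : Fin (n k) × Fin (n k) => (⟨k, t⟩ : Triple n) ∈ B).toList

lemma mem_slice {B : BadEvent n} {k : Fin N} {t : Fin (n k) × Fin (n k)} :
    t ∈ slice B k ↔ (⟨k, t⟩ : Triple n) ∈ B := by
  simp [slice]

lemma nodup_slice (B : BadEvent n) (k : Fin N) : (slice B k).Nodup :=
  Finset.nodup_toList _

lemma length_slice (B : BadEvent n) (k : Fin N) : (slice B k).length = countAt B k := by
  rw [slice, Finset.length_toList, countAt]
  refine Finset.card_bij (fun t _ => ⟨k, t⟩) ?_ ?_ ?_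
  · intro t ht
    simpa using ht
  · intro s _ t _ h
    simpa using h
  · rintro ⟨k', t⟩ h
    simp only [Finset.mem_filter] at h
    obtain ⟨h, rfl⟩ := h
    exact ⟨t, by simpa using h, rfl⟩

lemma Consistent.nodup_fst {B : BadEvent n} (hB : Consistent B) (k : Fin N) :
    ((slice B k).map Prod.fst).Nodup := by
  refine (List.nodup_map_iff_inj_on (nodup_slice B k)).mpr ?_
  rintro ⟨x, y⟩ h ⟨x', y'⟩ h' rfl
  rw [hB.1 k _ _ _ (mem_slice.mp h) (mem_slice.mp h')]

lemma Consistent.nodup_snd {B : BadEvent n} (hB : Consistent B) (k : Fin N) :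
    ((slice B k).map Prod.snd).Nodup := by
  refine (List.nodup_map_iff_inj_on (nodup_slice B k)).mpr ?_
  rintro ⟨x, y⟩ h ⟨x', y'⟩ h' rfl
  rw [hB.2 k _ _ _ (mem_slice.mp h) (mem_slice.mp h')]

lemma Holds.consistent {B : BadEvent n} {p : Config n} (h : Holds B p) : Consistent B :=
  ⟨fun _ _ _ _ h1 h2 => (h _ h1).symm.trans (h _ h2),
    fun k _ _ _ h1 h2 => (p k).injective ((h _ h1).trans (h _ h2).symm)⟩

lemma holds_iff_slice {B : BadEvent n} {p : Config n} :
    Holds B p ↔ ∀ k, ∀ t ∈ slice B k, p k t.1 = t.2 :=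
  ⟨fun h k t ht => h ⟨k, t⟩ (mem_slice.mp ht), fun h b hb => h b.1 b.2 (mem_slice.mpr hb)⟩

/-- The reciprocal of the number of equally likely outcomes of resampling `B`. -/
noncomputable def eventConst (B : BadEvent n) : ℝ≥0∞ :=
  ∏ k, (((n k).descFactorial (countAt B k) : ℕ) : ℝ≥0∞)⁻¹

open Classical in
/-- The transition matrix of resampling `B`, restricted to the configurations where `B` is true. -/
noncomputable def eventMatrix (B : BadEvent n) : Matrix (Config n) (Config n) ℝ≥0∞ :=
  fun p q => if Holds B p then
    eventConst B * tensor (fun k => ((slice B k).map pointMatrix).prod) p q else 0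

/-- For consistent `B` the point matrices already vanish where a condition fails, so the restriction
to true configurations is automatic. -/
lemma eventMatrix_of_consistent {B : BadEvent n} (hB : Consistent B) :
    eventMatrix B = eventConst B • tensor fun k => ((slice B k).map pointMatrix).prod := by
  ext p q
  simp only [eventMatrix, Matrix.smul_apply, smul_eq_mul]
  split_ifs with h
  · rfl
  · rw [holds_iff_slice] at h
    push Not at h
    obtain ⟨k, t, ht, hne⟩ := h
    rw [tensor, Finset.prod_eq_zero (Finset.mem_univ k), mul_zero]
    rw [prod_pointMatrix_apply _ (hB.nodup_fst k) (hB.nodup_snd k), if_neg]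
    exact fun h => hne (h t ht)

lemma eventMatrix_of_not_consistent {B : BadEvent n} (hB : ¬ Consistent B) :
    eventMatrix B = 0 := by
  ext p q
  exact if_neg fun h => hB h.consistent

lemma eventMatrix_apply_of_holds {B : BadEvent n} {p : Config n} (h : Holds B p)
    (xs : (k : Fin N) → List (Fin (n k)))
    (hxs : ∀ k, (xs k).Nodup ∧ (xs k).toFinset = entries B k) (q : Config n) :
    eventMatrix B p q = ∏ k, swapLaw (xs k) (p k) (q k) := by
  rw [eventMatrix, if_pos h, eventConst, tensor, ← Finset.prod_mul_distrib]
  refine Finset.prod_congr rfl fun k _ => ?_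
  have hp : (xs k).Perm ((slice B k).map Prod.fst) := by
    rw [List.perm_ext_iff_of_nodup (hxs k).1 (h.consistent.nodup_fst k)]
    intro x
    rw [← List.mem_toFinset, (hxs k).2, entries, List.mem_map]
    simp only [Finset.mem_filter, Finset.mem_univ, true_and, mem_slice, Prod.exists]
    constructor
    · rintro ⟨y, hy⟩
      exact ⟨x, y, hy, rfl⟩
    · rintro ⟨_, y, hy, rfl⟩
      exact ⟨y, hy⟩
  rw [swapLaw, swapLoop_apply _ _ (hxs k).1 (by simp), hp.length_eq, List.length_map,
    length_slice, loopMatrix_perm hp _ (hxs k).1 (by simp), Finset.card_empty, Nat.sub_zero,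
    prod_pointMatrix_apply _ (h.consistent.nodup_fst k) (h.consistent.nodup_snd k),
    if_pos (holds_iff_slice.mp h k)]

lemma eventMatrix_commute {B B' : BadEvent n} (h : ¬ Dep B B') :
    Commute (eventMatrix B) (eventMatrix B') := by
  by_cases hB : Consistent B
  swap
  · rw [eventMatrix_of_not_consistent hB]; exact Commute.zero_left _
  by_cases hB' : Consistent B'
  swap
  · rw [eventMatrix_of_not_consistent hB']; exact Commute.zero_right _
  rw [eventMatrix_of_consistent hB, eventMatrix_of_consistent hB']
  refine Commute.smul_left (Commute.smul_right ?_ _) _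
  rw [Commute, SemiconjBy, tensor_mul, tensor_mul]
  congr 1
  funext k
  refine Commute.list_prod_left _ _ fun X hX => Commute.list_prod_right _ _ fun Y hY => ?_
  obtain ⟨s, hs, rfl⟩ := List.mem_map.mp hX
  obtain ⟨t, ht, rfl⟩ := List.mem_map.mp hY
  refine pointMatrix_commute (fun e => h ?_) (fun e => h ?_)
  · exact ⟨k, s.1, s.2, t.1, t.2, mem_slice.mp hs, mem_slice.mp ht, Or.inl e⟩
  · exact ⟨k, s.1, s.2, t.1, t.2, mem_slice.mp hs, mem_slice.mp ht, Or.inr e⟩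

lemma sum_eventMatrix_right {B : BadEvent n} {p : Config n} (h : Holds B p) :
    ∑ q, eventMatrix B p q = 1 := by
  have hxs : ∀ k, ((entries B k).toList).Nodup ∧ ((entries B k).toList).toFinset = entries B k :=
    fun k => ⟨Finset.nodup_toList _, Finset.toList_toFinset _⟩
  simp only [eventMatrix_apply_of_holds h _ hxs]
  rw [← Fintype.prod_sum fun k r => swapLaw (entries B k).toList (p k) r]
  refine Finset.prod_eq_one fun k _ => ?_
  rw [← tsum_fintype (L := .unconditional _), PMF.tsum_coe]

lemma sum_eventMatrix_left {B : BadEvent n} (hB : Consistent B) (q : Config n) :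
    ∑ p, eventMatrix B p q = eventConst B := by
  rw [eventMatrix_of_consistent hB]
  simp only [Matrix.smul_apply, smul_eq_mul, ← Finset.mul_sum]
  rw [sum_tensor]
  simp [sum_prod_pointMatrix]

/-- Count the total mass of `eventMatrix B` twice: by columns, all with the same sum, and by rows,
with sum 1 or 0 according to whether `B` holds. -/
lemma eventConst_mul_card {B : BadEvent n} (hB : Consistent B) [DecidablePred (Holds B)] :
    eventConst B * Fintype.card (Config n) =
      ((Finset.univ.filter fun p : Config n => Holds B p).card : ℝ≥0∞) := by
  calc _ = ∑ q, ∑ p, eventMatrix B p q := by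
        simp [sum_eventMatrix_left hB, mul_comm]
    _ = ∑ p, if Holds B p then 1 else 0 := by
        rw [Finset.sum_comm]
        refine Finset.sum_congr rfl fun p _ => ?_
        split_ifs with h
        · exact sum_eventMatrix_right h
        · exact Finset.sum_eq_zero fun q _ => if_neg h
    _ = _ := by simp

lemma probOmega_eq_toReal {B : BadEvent n} (hB : Consistent B) :
    probOmega B = (eventConst B).toReal := by
  classical
  have h := congrArg ENNReal.toReal (eventConst_mul_card hB)
  rw [ENNReal.toReal_mul, ENNReal.toReal_natCast, ENNReal.toReal_natCast] at h
  rw [probOmega, div_eq_iff (by exact_mod_cast Fintype.card_ne_zero), h]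

lemma probOmega_of_not_consistent {B : BadEvent n} (hB : ¬ Consistent B) : probOmega B = 0 := by
  classical
  have h : ∀ p : Config n, ¬ Holds B p := fun p h => hB h.consistent
  simp [probOmega, h]

lemma probOmega_nonneg (B : BadEvent n) : 0 ≤ probOmega B := by
  unfold probOmega; positivity

lemma countAt_le {B : BadEvent n} (hB : Consistent B) (k : Fin N) : countAt B k ≤ n k := by
  simpa [length_slice] using (hB.nodup_fst k).length_le_card

theorem probOmega_of_consistent {B : BadEvent n} (hB : Consistent B) :
    probOmega B = ∏ k, ((n k - countAt B k).factorial : ℝ) / ((n k).factorial : ℝ) := by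
  rw [probOmega_eq_toReal hB, eventConst, ENNReal.toReal_prod]
  refine Finset.prod_congr rfl fun k _ => ?_
  have h := Nat.factorial_mul_descFactorial (countAt_le hB k)
  have h0 : ((n k).descFactorial (countAt B k) : ℝ) ≠ 0 := by
    exact_mod_cast (Nat.descFactorial_pos.mpr (countAt_le hB k)).ne'
  rw [ENNReal.toReal_inv, ENNReal.toReal_natCast, eq_div_iff (by positivity), ← h, Nat.cast_mul]
  field_simp

lemma sum_eventMatrix_mul (B : BadEvent n) (X : Matrix (Config n) (Config n) ℝ≥0∞)
    (q : Config n) :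
    ∑ p, (eventMatrix B * X) p q = ENNReal.ofReal (probOmega B) * ∑ p, X p q := by
  by_cases hB : Consistent B
  · have hne : eventConst B ≠ ⊤ := by
      refine ENNReal.prod_ne_top fun k _ => ENNReal.inv_ne_top.mpr ?_
      exact_mod_cast (Nat.descFactorial_pos.mpr (countAt_le hB k)).ne'
    simp only [Matrix.mul_apply]
    rw [Finset.sum_comm]
    simp only [← Finset.sum_mul, sum_eventMatrix_left hB]
    rw [← Finset.mul_sum, probOmega_eq_toReal hB, ENNReal.ofReal_toReal hne]
  · simp [eventMatrix_of_not_consistent hB, probOmega_of_not_consistent hB]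

end Configurations

-- Levels of witness trees and reversal of the backward construction

namespace WitnessTree

section Levels

variable {α : Type}

/-- The labels of the nodes of depth `d`, from left to right. -/
def levelLabels : ℕ → WitnessTree α → List α
  | 0, node a _ => [a]
  | d + 1, node _ ts => ts.flatMap (levelLabels d)

lemma HasNode.of_mem_levelLabels {d : ℕ} {t : WitnessTree α} {a : α}
    (h : a ∈ levelLabels d t) : HasNode t d a := by
  induction d generalizing t with
  | zero =>
    obtain ⟨c, ts⟩ := t
    rw [levelLabels, List.mem_singleton] at h
    exact h ▸ .root _ _
  | succ d ih =>
    obtain ⟨c, ts⟩ := t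
    rw [levelLabels, List.mem_flatMap] at h
    obtain ⟨u, hu, ha⟩ := h
    exact .child _ _ u _ _ hu (ih ha)

lemma HasNode.mem_levelLabels {d : ℕ} {t : WitnessTree α} {a : α}
    (h : HasNode t d a) : a ∈ levelLabels d t := by
  induction h with
  | root => simp [levelLabels]
  | child a ts t d b ht _ ih => exact List.mem_flatMap.mpr ⟨t, ht, ih⟩

mutual

lemma levelLabels_eq_nil : ∀ (t : WitnessTree α) (d : ℕ), (labels t).length ≤ d →
    levelLabels d t = []
  | node a ts, 0, h => by simp [labels] at h
  | node a ts, d + 1, h => by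
    rw [levelLabels]
    exact flatMap_levelLabels_eq_nil ts d (by simpa [labels] using h)

lemma flatMap_levelLabels_eq_nil : ∀ (ts : List (WitnessTree α)) (d : ℕ),
    (forestLabels ts).length ≤ d → ts.flatMap (levelLabels d) = []
  | [], _, _ => rfl
  | t :: ts, d, h => by
    rw [forestLabels, List.length_append] at h
    rw [List.flatMap_cons, levelLabels_eq_nil t d (by omega),
      flatMap_levelLabels_eq_nil ts d (by omega), List.nil_append]

end

mutual

lemma prod_levelLabels {M : Type*} [CommMonoid M] (g : α → M) : ∀ (t : WitnessTree α) (D : ℕ),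
    (labels t).length ≤ D →
      ∏ d ∈ Finset.range D, ((levelLabels d t).map g).prod = ((labels t).map g).prod
  | node a ts, 0, h => by simp [labels] at h
  | node a ts, D + 1, h => by
    rw [Finset.prod_range_succ', labels, List.map_cons, List.prod_cons, mul_comm]
    simp only [levelLabels]
    rw [prod_flatMap_levelLabels g ts D (by simpa [labels] using h)]
    simp

lemma prod_flatMap_levelLabels {M : Type*} [CommMonoid M] (g : α → M) :
    ∀ (ts : List (WitnessTree α)) (D : ℕ), (forestLabels ts).length ≤ D →
      ∏ d ∈ Finset.range D, ((ts.flatMap (levelLabels d)).map g).prod =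
        ((forestLabels ts).map g).prod
  | [], _, _ => by simp [forestLabels]
  | t :: ts, D, h => by
    rw [forestLabels, List.length_append] at h
    simp only [List.flatMap_cons, List.map_append, List.prod_append, forestLabels,
      Finset.prod_mul_distrib]
    rw [prod_levelLabels g t D (by omega), prod_flatMap_levelLabels g ts D (by omega)]

end

/-- The product of the `f`-values of all labels of depth less than `D`, the deepest levels
first. -/
def levelProd {M : Type*} [Monoid M] (f : α → M) : ℕ → WitnessTree α → M
  | 0, _ => 1
  | D + 1, t => ((levelLabels D t).map f).prod * levelProd f D t

lemma levelProd_congr {M : Type*} [Monoid M] (f : α → M) {D : ℕ} {t t' : WitnessTree α}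
    (h : ∀ d < D, levelLabels d t = levelLabels d t') : levelProd f D t = levelProd f D t' := by
  induction D with
  | zero => rfl
  | succ D ih =>
    rw [levelProd, levelProd, h D (by omega), ih fun d hd => h d (by omega)]

lemma commute_levelProd {M : Type*} [Monoid M] (f : α → M) {b : α} {D : ℕ} {t : WitnessTree α}
    (h : ∀ d, ∀ a ∈ levelLabels d t, Commute (f b) (f a)) : Commute (f b) (levelProd f D t) := by
  induction D with
  | zero => exact Commute.one_right _
  | succ D ih =>
    refine Commute.mul_right (Commute.list_prod_right _ _ fun x hx => ?_) ih
    obtain ⟨a, ha, rfl⟩ := List.mem_map.mp hx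
    exact h D a ha

lemma AddLeaf.zero_inv {b a : α} {t s : WitnessTree α} (h : AddLeaf b 0 a t s) :
    ∃ l r, t = node a (l ++ r) ∧ s = node a (l ++ node b [] :: r) := by
  cases h with
  | here l r => exact ⟨_, _, rfl, rfl⟩

lemma AddLeaf.succ_inv {b a : α} {d : ℕ} {t s : WitnessTree α} (h : AddLeaf b (d + 1) a t s) :
    ∃ c l r u v, t = node c (l ++ u :: r) ∧ s = node c (l ++ v :: r) ∧ AddLeaf b d a u v := by
  cases h with
  | deeper c l r d a u v h => exact ⟨_, _, _, _, _, rfl, rfl, h⟩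

lemma AddLeaf.levelLabels_of_ne {b a : α} {d : ℕ} {t s : WitnessTree α} (h : AddLeaf b d a t s)
    {e : ℕ} (he : e ≠ d + 1) : levelLabels e s = levelLabels e t := by
  induction h generalizing e with
  | here a l r =>
    match e, he with
    | 0, _ => simp [levelLabels]
    | e + 2, _ => simp [levelLabels]
  | deeper c l r d a u v _ ih =>
    match e, he with
    | 0, _ => simp [levelLabels]
    | e + 1, he => simp [levelLabels, ih (e := e) (by omega)]

lemma AddLeaf.levelLabels_succ {b a : α} {d : ℕ} {t s : WitnessTree α} (h : AddLeaf b d a t s) :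
    ∃ l r, levelLabels (d + 1) t = l ++ r ∧ levelLabels (d + 1) s = l ++ b :: r := by
  induction h with
  | here a l r =>
    exact ⟨l.flatMap (levelLabels 0), r.flatMap (levelLabels 0), by simp [levelLabels],
      by simp [levelLabels]⟩
  | deeper c l r d a u v _ ih =>
    obtain ⟨l', r', h1, h2⟩ := ih
    refine ⟨l.flatMap (levelLabels (d + 1)) ++ l', r' ++ r.flatMap (levelLabels (d + 1)), ?_, ?_⟩
    · rw [levelLabels, List.flatMap_append, List.flatMap_cons, h1]; simp
    · rw [levelLabels, List.flatMap_append, List.flatMap_cons, h2]; simp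

lemma AddLeaf.mem_levelLabels {b a : α} {d : ℕ} {t s : WitnessTree α} (h : AddLeaf b d a t s) :
    a ∈ levelLabels d t := by
  induction h with
  | here a l r => simp [levelLabels]
  | deeper c l r d a u v _ ih => simp [levelLabels, ih]

lemma append_cons_inj_of_unique {β : Type*} {P : β → Prop} {l r l' r' : List β} {x x' : β}
    (h : l ++ x :: r = l' ++ x' :: r') (hx : P x) (hx' : P x') (hl : ∀ y ∈ l, ¬ P y)
    (hl' : ∀ y ∈ l', ¬ P y) : l = l' ∧ x = x' ∧ r = r' := by
  induction l generalizing l' with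
  | nil =>
    cases l' with
    | nil => simpa using h
    | cons y l' =>
      rw [List.nil_append, List.cons_append, List.cons.injEq] at h
      exact absurd (h.1 ▸ hx) (hl' y (by simp))
  | cons z l ih =>
    cases l' with
    | nil =>
      rw [List.nil_append, List.cons_append, List.cons.injEq] at h
      exact absurd (h.1 ▸ hx') (hl z (by simp))
    | cons y l' =>
      rw [List.cons_append, List.cons_append, List.cons.injEq] at h
      have := ih h.2 (fun w hw => hl w (by simp [hw])) fun w hw => hl' w (by simp [hw])
      exact ⟨by rw [h.1, this.1], this.2⟩

/-- The new leaf is the only node labeled `b` on its level of `s`, so the path to it, and hence the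
tree without it, can be read off from `s`. -/
lemma AddLeaf.unique {b a a' : α} {d : ℕ} {t t' s : WitnessTree α} (h : AddLeaf b d a t s)
    (h' : AddLeaf b d a' t' s) (hb : b ∉ levelLabels (d + 1) t)
    (hb' : b ∉ levelLabels (d + 1) t') : t = t' := by
  induction d generalizing t t' s with
  | zero =>
    obtain ⟨l, r, rfl, rfl⟩ := h.zero_inv
    obtain ⟨l', r', rfl, e⟩ := h'.zero_inv
    rw [node.injEq] at e
    obtain ⟨rfl, e⟩ := e
    simp only [levelLabels, List.mem_flatMap, List.mem_append, not_exists, not_and] at hb hb'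
    have := append_cons_inj_of_unique (P := fun u => b ∈ levelLabels 0 u) e
      (by simp [levelLabels]) (by simp [levelLabels]) (fun y hy => hb y (Or.inl hy))
      (fun y hy => hb' y (Or.inl hy))
    rw [this.1, this.2.2]
  | succ d ih =>
    obtain ⟨c, l, r, u, v, rfl, rfl, k⟩ := h.succ_inv
    obtain ⟨c', l', r', u', v', rfl, e, k'⟩ := h'.succ_inv
    rw [node.injEq] at e
    obtain ⟨rfl, e⟩ := e
    rw [levelLabels] at hb hb'
    simp only [List.mem_flatMap, not_exists, not_and] at hb hb'
    have hv : ∀ {a u v}, AddLeaf b d a u v → b ∈ levelLabels (d + 1) v := fun k => by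
      obtain ⟨_, _, _, h⟩ := k.levelLabels_succ
      simp [h]
    obtain ⟨rfl, rfl, rfl⟩ := append_cons_inj_of_unique (P := fun u => b ∈ levelLabels (d + 1) u) e
      (hv k) (hv k') (fun y hy => hb y (by simp [hy])) (fun y hy => hb' y (by simp [hy]))
    rw [ih k k' (hb u (by simp)) (hb' u' (by simp))]

lemma BackStep.eq_of_not_rel {rel : α → α → Prop} {b : α} {t s : WitnessTree α}
    (h : BackStep rel b t s) (hs : ∀ d, ∀ a ∈ levelLabels d s, ¬ rel b a) : t = s := by
  cases h with
  | ignore => rfl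
  | attach d a _ _ hadd hrel _ =>
    refine absurd hrel (hs d a ?_)
    rw [hadd.levelLabels_of_ne (by omega)]
    exact hadd.mem_levelLabels

lemma BackStep.exists_addLeaf {rel : α → α → Prop} {b : α} {t s : WitnessTree α}
    (h : BackStep rel b t s) (hs : ∃ d, ∃ a ∈ levelLabels d s, rel b a) :
    ∃ d a, AddLeaf b d a t s ∧ rel b a ∧ ∀ d', ∀ a' ∈ levelLabels d' t, rel b a' → d' ≤ d := by
  cases h with
  | ignore _ hno =>
    obtain ⟨d, a, ha, hrel⟩ := hs
    exact absurd hrel (hno d a (.of_mem_levelLabels ha))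
  | attach d a _ _ hadd hrel hmax =>
    exact ⟨d, a, hadd, hrel, fun d' a' h => hmax d' a' (.of_mem_levelLabels h)⟩

/-- Since `b` is related to itself, maximality of the depth forbids other nodes labeled `b` at the
level of the new leaf or below. This fixes the depth, and `AddLeaf.unique` does the rest. -/
lemma BackStep.unique {rel : α → α → Prop} (hrefl : ∀ a b, rel a b → rel a a) {b : α}
    {t t' s : WitnessTree α} (h : BackStep rel b t s) (h' : BackStep rel b t' s)
    (hs : ∃ d, ∃ a ∈ levelLabels d s, rel b a) : t = t' := by
  obtain ⟨d, a, hadd, hrel, hmax⟩ := h.exists_addLeaf hs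
  obtain ⟨d', a', hadd', -, hmax'⟩ := h'.exists_addLeaf hs
  have hb := hrefl _ _ hrel
  have key : ∀ {d d' a a' t t'}, AddLeaf b d a t s → AddLeaf b d' a' t' s →
      (∀ e, ∀ c ∈ levelLabels e t, rel b c → e ≤ d) → d' ≤ d := by
    intro d d' a a' t t' k k' hm
    by_contra hlt
    have := hm (d' + 1) b (by
      rw [← k.levelLabels_of_ne (by omega)]
      obtain ⟨_, _, _, e⟩ := k'.levelLabels_succ
      simp [e]) hb
    omega
  obtain rfl : d = d' := le_antisymm (key hadd' hadd hmax') (key hadd hadd' hmax)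
  refine hadd.unique hadd' (fun hm => ?_) (fun hm => ?_)
  · have := hmax _ _ hm hb
    omega
  · have := hmax' _ _ hm hb
    omega

/-- The factors to the left of the new `f b` belong to levels deeper than `d`, where no label is
related to `b`. -/
lemma AddLeaf.levelProd_eq {M : Type*} [Monoid M] (f : α → M) {rel : α → α → Prop} {b a : α}
    {d D : ℕ} {t s : WitnessTree α} (hcomm : ∀ c, ¬ rel b c → Commute (f b) (f c))
    (h : AddLeaf b d a t s) (hmax : ∀ d', ∀ a' ∈ levelLabels d' t, rel b a' → d' ≤ d)
    (hD : d + 1 < D) : levelProd f D s = f b * levelProd f D t := by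
  have hc : ∀ e, d < e → ∀ c ∈ levelLabels e t, Commute (f b) (f c) := fun e he c hm =>
    hcomm c fun hr => by have := hmax e c hm hr; omega
  induction D, hD using Nat.le_induction with
  | base =>
    obtain ⟨l, r, h1, h2⟩ := h.levelLabels_succ
    have hl : Commute (f b) (l.map f).prod := Commute.list_prod_right _ _ fun x hx => by
      obtain ⟨c, hcm, rfl⟩ := List.mem_map.mp hx
      exact hc (d + 1) (by omega) c (by simp [h1, hcm])
    change ((levelLabels (d + 1) s).map f).prod * levelProd f (d + 1) s =
      f b * (((levelLabels (d + 1) t).map f).prod * levelProd f (d + 1) t)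
    rw [h1, h2, levelProd_congr f fun e he => h.levelLabels_of_ne (e := e) (by omega)]
    simp only [List.map_append, List.map_cons, List.prod_append, List.prod_cons, ← mul_assoc]
    rw [hl.eq]
  | succ D hD ih =>
    have hl : Commute (f b) ((levelLabels D t).map f).prod :=
      Commute.list_prod_right _ _ fun x hx => by
        obtain ⟨c, hcm, rfl⟩ := List.mem_map.mp hx
        exact hc D (by omega) c hcm
    rw [levelProd, levelProd, h.levelLabels_of_ne (by omega), ih, ← mul_assoc, ← mul_assoc, hl.eq]

end Levels

end WitnessTree

-- The probability that a tree appears, conditionally on the past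

section Run

variable {N : ℕ} {n : Fin N → ℕ}

open WitnessTree

lemma sum_prod_eventMatrix_mul (L : List (BadEvent n))
    (X : Matrix (Config n) (Config n) ℝ≥0∞) (q : Config n) :
    ∑ p, ((L.map eventMatrix).prod * X) p q =
      (L.map fun B => ENNReal.ofReal (probOmega B)).prod * ∑ p, X p q := by
  induction L with
  | nil => simp
  | cons B L ih =>
    rw [List.map_cons, List.prod_cons, mul_assoc, sum_eventMatrix_mul, ih, List.map_cons,
      List.prod_cons, mul_assoc]

lemma sum_levelProd_eventMatrix (D : ℕ) (τ : WitnessTree (BadEvent n)) (q : Config n) :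
    ∑ p, levelProd eventMatrix D τ p q =
      ∏ d ∈ Finset.range D, ((levelLabels d τ).map fun B => ENNReal.ofReal (probOmega B)).prod := by
  induction D with
  | zero => simp [levelProd, Matrix.one_apply]
  | succ D ih => rw [levelProd, sum_prod_eventMatrix_mul, ih, Finset.prod_range_succ, mul_comm]

/-- `τ` is the witness tree of one of the first `j` resampled events. -/
def AppearsWithin (j : ℕ) (τ : WitnessTree (BadEvent n)) (e : ℕ → Option (BadEvent n)) : Prop :=
  ∃ T < j, ∃ l : List (BadEvent n),
    (List.range (T + 1)).map e = l.map some ∧ IsBuiltFrom Dep l τ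

lemma appears_iff_exists_appearsWithin (τ : WitnessTree (BadEvent n))
    (e : ℕ → Option (BadEvent n)) : Appears τ e ↔ ∃ j, AppearsWithin j τ e :=
  ⟨fun ⟨T, l, h⟩ => ⟨T + 1, T, T.lt_succ_self, l, h⟩, fun ⟨_, T, _, l, h⟩ => ⟨T, l, h⟩⟩

lemma AppearsWithin.mono {i j : ℕ} (hij : i ≤ j) {τ : WitnessTree (BadEvent n)}
    {e : ℕ → Option (BadEvent n)} (h : AppearsWithin i τ e) : AppearsWithin j τ e :=
  let ⟨T, hT, h⟩ := h
  ⟨T, hT.trans_le hij, h⟩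

lemma AppearsWithin.cases_head {j : ℕ} {τ : WitnessTree (BadEvent n)}
    {e : ℕ → Option (BadEvent n)} (h : AppearsWithin (j + 1) τ e) :
    ∃ B, e 0 = some B ∧ (τ = node B [] ∨
      ∃ τ', BackStep Dep B τ' τ ∧ AppearsWithin j τ' fun s => e (s + 1)) := by
  obtain ⟨T, hT, l, hl, hb⟩ := h
  rw [List.range_succ_eq_map, List.map_cons, List.map_map] at hl
  cases hb with
  | start b => exact ⟨b, (List.cons.inj hl).1, Or.inl rfl⟩
  | back b l τ' _ hb hstep =>
    rw [List.map_cons, List.cons.injEq] at hl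
    refine ⟨b, hl.1, Or.inr ⟨τ', hstep, ?_⟩⟩
    cases T with
    | zero =>
      have : l = [] := by simpa using hl.2.symm
      subst this
      cases hb
    | succ T => exact ⟨T, by omega, l, hl.2, hb⟩

lemma Dep.refl_left {B B' : BadEvent n} (h : Dep B B') : Dep B B := by
  obtain ⟨k, x, y, _, _, hB, -, -⟩ := h
  exact ⟨k, x, y, x, y, hB, hB, Or.inl rfl⟩

variable {Ω : Type*} {conf : ℕ → Ω → Config n} {ev : ℕ → Ω → Option (BadEvent n)}

/-- The set of outcomes whose history up to the choice at time `t` is given by `p` and `b`. -/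
def history (conf : ℕ → Ω → Config n) (ev : ℕ → Ω → Option (BadEvent n)) (t : ℕ)
    (p : ℕ → Config n) (b : ℕ → Option (BadEvent n)) : Set Ω :=
  {ω | ∀ s ≤ t, conf s ω = p s ∧ ev s ω = b s}

/-- The set of outcomes whose history before the choice at time `t` is given by `p` and `b`. -/
def preHistory (conf : ℕ → Ω → Config n) (ev : ℕ → Ω → Option (BadEvent n)) (t : ℕ)
    (p : ℕ → Config n) (b : ℕ → Option (BadEvent n)) : Set Ω :=
  {ω | (∀ s < t, conf s ω = p s ∧ ev s ω = b s) ∧ conf t ω = p t}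

lemma preHistory_inter (t : ℕ) (p : ℕ → Config n) (b : ℕ → Option (BadEvent n))
    (c : Option (BadEvent n)) :
    preHistory conf ev t p b ∩ {ω | ev t ω = c} =
      history conf ev t p (Function.update b t c) := by
  ext ω
  simp only [preHistory, history, Set.mem_inter_iff, Set.mem_ofPred_eq]
  constructor
  · rintro ⟨⟨h, h1⟩, h2⟩ s hs
    rcases hs.lt_or_eq with hs | rfl
    · rw [Function.update_of_ne hs.ne]; exact h s hs
    · rw [Function.update_self]; exact ⟨h1, h2⟩
  · intro h
    refine ⟨⟨fun s hs => ?_, (h t le_rfl).1⟩, by simpa using (h t le_rfl).2⟩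
    have := h s hs.le
    rwa [Function.update_of_ne hs.ne] at this

lemma history_inter (t : ℕ) (p : ℕ → Config n) (b : ℕ → Option (BadEvent n)) (q : Config n) :
    history conf ev t p b ∩ {ω | conf (t + 1) ω = q} =
      preHistory conf ev (t + 1) (Function.update p (t + 1) q) b := by
  ext ω
  simp only [preHistory, history, Set.mem_inter_iff, Set.mem_ofPred_eq, Function.update_self,
    Nat.lt_succ_iff]
  refine and_congr_left fun _ => forall₂_congr fun s hs => ?_
  rw [Function.update_of_ne (by omega)]

variable [MeasurableSpace Ω] {P : Measure Ω} {𝓑 : Set (BadEvent n)}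

lemma IsSwappingRun.measurableSet_preHistory (hrun : IsSwappingRun 𝓑 P conf ev) (t : ℕ)
    (p : ℕ → Config n) (b : ℕ → Option (BadEvent n)) :
    MeasurableSet (preHistory conf ev t p b) := by
  have : preHistory conf ev t p b =
      (⋂ s, ⋂ (_ : s < t), {ω | conf s ω = p s} ∩ {ω | ev s ω = b s}) ∩
        {ω | conf t ω = p t} := by
    ext ω; simp [preHistory]
  rw [this]
  exact (MeasurableSet.iInter fun s => MeasurableSet.iInter fun _ =>
    (hrun.measurableSet_conf s _).inter (hrun.measurableSet_ev s _)).inter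
      (hrun.measurableSet_conf t _)

/-- Only an inequality, because the algorithm may have stopped. -/
lemma IsSwappingRun.sum_measure_history_le (hrun : IsSwappingRun 𝓑 P conf ev) (t : ℕ)
    (p : ℕ → Config n) (b : ℕ → Option (BadEvent n)) :
    ∑ B : BadEvent n, P (history conf ev t p (Function.update b t (some B))) ≤
      P (preHistory conf ev t p b) := by
  simp only [← preHistory_inter]
  rw [← tsum_fintype (L := .unconditional _), ← measure_iUnion]
  · exact measure_mono (Set.iUnion_subset fun _ => Set.inter_subset_left)
  · intro B B' hne
    refine Set.disjoint_left.mpr fun ω h h' => hne ?_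
    exact Option.some.inj (h.2.symm.trans h'.2)
  · exact fun B => (hrun.measurableSet_preHistory t p b).inter (hrun.measurableSet_ev t _)

lemma measure_le_sum_inter {ι : Type*} [Fintype ι] (f : Ω → ι) (S : Set Ω) :
    P S ≤ ∑ i, P (S ∩ {ω | f ω = i}) := by
  have h : S ⊆ ⋃ i, S ∩ {ω | f ω = i} := fun ω hω => Set.mem_iUnion.mpr ⟨f ω, hω, rfl⟩
  exact (measure_mono h).trans (measure_iUnion_fintype_le P _)

/-- The outcomes for which `τ` is the witness tree of one of the `j` events resampled from time `t`
on, in the log starting at time `t`. -/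
def appearsFrom (ev : ℕ → Ω → Option (BadEvent n)) (t j : ℕ) (τ : WitnessTree (BadEvent n)) :
    Set Ω :=
  {ω | AppearsWithin j τ fun s => ev (t + s) ω}

/-- The bound on the conditional probability that `τ` appears. -/
def AppearanceBound (P : Measure Ω) (conf : ℕ → Ω → Config n)
    (ev : ℕ → Ω → Option (BadEvent n)) (j : ℕ) : Prop :=
  ∀ (t : ℕ) (p : ℕ → Config n) (b : ℕ → Option (BadEvent n)) (τ : WitnessTree (BadEvent n))
    (D : ℕ), (∀ e ≥ D, levelLabels e τ = []) →
      P (preHistory conf ev t p b ∩ appearsFrom ev t j τ) ≤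
        P (preHistory conf ev t p b) * ∑ q, levelProd eventMatrix D τ (p t) q

lemma IsSwappingRun.measure_history_inter_le (hrun : IsSwappingRun 𝓑 P conf ev) {j : ℕ}
    (ih : AppearanceBound P conf ev j) (t : ℕ) (p : ℕ → Config n)
    (b : ℕ → Option (BadEvent n)) {B : BadEvent n} (hbt : b t = some B) (hB : Holds B (p t))
    (τ : WitnessTree (BadEvent n)) (D : ℕ) (hD : ∀ e ≥ D, levelLabels e τ = []) :
    P (history conf ev t p b ∩ appearsFrom ev (t + 1) j τ) ≤
      P (history conf ev t p b) *
        ∑ q, (eventMatrix B * levelProd eventMatrix D τ) (p t) q := by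
  obtain ⟨xs, hxs, hlaw⟩ := hrun.resample t p b B hbt
  refine (measure_le_sum_inter (conf (t + 1)) _).trans ?_
  simp only [Matrix.mul_apply]
  rw [Finset.sum_comm, Finset.mul_sum]
  refine Finset.sum_le_sum fun p' _ => ?_
  rw [Set.inter_right_comm, history_inter]
  refine (ih _ _ _ τ D hD).trans_eq ?_
  rw [← history_inter, Function.update_self, eventMatrix_apply_of_holds hB xs hxs,
    ← Finset.mul_sum, ← mul_assoc]
  congr 1
  exact hlaw p'

lemma IsSwappingRun.holds_of_measure_ne_zero (hrun : IsSwappingRun 𝓑 P conf ev) {t : ℕ}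
    {p : ℕ → Config n} {b : ℕ → Option (BadEvent n)} {B : BadEvent n} (hbt : b t = some B)
    (h0 : P (history conf ev t p b) ≠ 0) : Holds B (p t) := by
  by_contra hB
  refine h0 (measure_eq_zero_iff_ae_notMem.mpr ?_)
  filter_upwards [hrun.chosen] with ω hc hω
  have h := hω t le_rfl
  exact hB (h.1 ▸ (hc t B (h.2.trans hbt)).2)

lemma levelProd_node_nil (B : BadEvent n) {D : ℕ} (hD : 0 < D) :
    levelProd eventMatrix D (node B []) = eventMatrix B := by
  induction D, hD using Nat.le_induction with
  | base => simp [levelProd, levelLabels]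
  | succ D hD ih =>
    obtain ⟨D, rfl⟩ : ∃ r, D = r + 1 := ⟨D - 1, by omega⟩
    rw [levelProd, ih]
    simp [levelLabels]

lemma IsSwappingRun.measure_history_inter_appearsFrom_succ_le
    (hrun : IsSwappingRun 𝓑 P conf ev) {j : ℕ} (ih : AppearanceBound P conf ev j) (t : ℕ)
    (p : ℕ → Config n) (b : ℕ → Option (BadEvent n)) {B : BadEvent n} (hbt : b t = some B)
    (τ : WitnessTree (BadEvent n)) (D : ℕ) (hD : ∀ e ≥ D, levelLabels e τ = []) :
    P (history conf ev t p b ∩ appearsFrom ev t (j + 1) τ) ≤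
      P (history conf ev t p b) * ∑ q, levelProd eventMatrix D τ (p t) q := by
  by_cases h0 : P (history conf ev t p b) = 0
  · exact (measure_mono Set.inter_subset_left).trans (by simp [h0])
  have hB := hrun.holds_of_measure_ne_zero hbt h0
  have hstep : ∀ ω ∈ history conf ev t p b ∩ appearsFrom ev t (j + 1) τ, τ = node B [] ∨
      ∃ τ', BackStep Dep B τ' τ ∧ ω ∈ appearsFrom ev (t + 1) j τ' := by
    rintro ω ⟨h, h'⟩
    obtain ⟨B', hB', h'⟩ := AppearsWithin.cases_head h'
    obtain rfl : B = B' := Option.some.inj (hbt.symm.trans ((h t le_rfl).2.symm.trans hB'))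
    have hshift : (fun s => ev (t + (s + 1)) ω) = fun s => ev (t + 1 + s) ω := by
      funext s
      rw [add_assoc, add_comm 1]
    rwa [hshift] at h'
  by_cases hroot : τ = node B []
  · subst hroot
    have hpos : 0 < D := by
      by_contra hD0
      simpa [levelLabels] using hD 0 (by omega)
    -- As `B` is true at `p t`, the row sum is 1 and the bound is trivial.
    rw [levelProd_node_nil B hpos, sum_eventMatrix_right hB, mul_one]
    exact measure_mono Set.inter_subset_left
  by_cases hrel : ∃ d, ∃ a ∈ levelLabels d τ, Dep B a
  · by_cases hex : ∃ τ', BackStep Dep B τ' τ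
    · obtain ⟨τ', hτ'⟩ := hex
      obtain ⟨d, a, hadd, -, hmax⟩ := hτ'.exists_addLeaf hrel
      obtain ⟨l, r, h1, h2⟩ := hadd.levelLabels_succ
      have hdD : d + 1 < D := by
        by_contra hlt
        rw [hD (d + 1) (by omega)] at h2
        simp at h2
      rw [hadd.levelProd_eq eventMatrix (fun c => eventMatrix_commute) hmax hdD]
      -- Uniqueness of the previous tree avoids a union bound over several candidates.
      have hsub : history conf ev t p b ∩ appearsFrom ev t (j + 1) τ ⊆
          history conf ev t p b ∩ appearsFrom ev (t + 1) j τ' := by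
        intro ω hω
        obtain ⟨τ'', h, h'⟩ := (hstep ω hω).resolve_left hroot
        rw [BackStep.unique (rel := Dep) (fun _ _ => Dep.refl_left) hτ' h hrel]
        exact ⟨hω.1, h'⟩
      refine (measure_mono hsub).trans
        (hrun.measure_history_inter_le ih t p b hbt hB τ' D fun e he => ?_)
      · rw [← hadd.levelLabels_of_ne (by omega), hD e he]
    · have hemp : history conf ev t p b ∩ appearsFrom ev t (j + 1) τ = ∅ := by
        refine Set.eq_empty_iff_forall_notMem.mpr fun ω hω => ?_
        obtain ⟨τ', h, -⟩ := (hstep ω hω).resolve_left hroot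
        exact hex ⟨τ', h⟩
      rw [hemp, measure_empty]
      exact zero_le
  · push Not at hrel
    have hsub : history conf ev t p b ∩ appearsFrom ev t (j + 1) τ ⊆
        history conf ev t p b ∩ appearsFrom ev (t + 1) j τ := by
      intro ω hω
      obtain ⟨τ', h, h'⟩ := (hstep ω hω).resolve_left hroot
      rw [h.eq_of_not_rel hrel] at h'
      exact ⟨hω.1, h'⟩
    refine (measure_mono hsub).trans
      ((hrun.measure_history_inter_le ih t p b hbt hB τ D hD).trans ?_)
    · rw [(commute_levelProd eventMatrix fun d a ha => eventMatrix_commute (hrel d a ha)).eq]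
      simp only [Matrix.mul_apply]
      rw [Finset.sum_comm]
      gcongr with q
      rw [← Finset.mul_sum]
      refine mul_le_of_le_one_right' ?_
      by_cases hq : Holds B q
      · exact (sum_eventMatrix_right hq).le
      · simp [eventMatrix, hq]

lemma IsSwappingRun.appearanceBound (hrun : IsSwappingRun 𝓑 P conf ev) (j : ℕ) :
    AppearanceBound P conf ev j := by
  induction j with
  | zero =>
    intro t p b τ D _
    have : appearsFrom ev t 0 τ = ∅ :=
      Set.eq_empty_iff_forall_notMem.mpr fun ω ⟨T, hT, _⟩ => absurd hT T.not_lt_zero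
    simp [this]
  | succ j ih =>
    intro t p b τ D hD
    calc P (preHistory conf ev t p b ∩ appearsFrom ev t (j + 1) τ)
        ≤ P (⋃ B : BadEvent n, history conf ev t p (Function.update b t (some B)) ∩
            appearsFrom ev t (j + 1) τ) := by
          refine measure_mono fun ω hω => ?_
          obtain ⟨B, hB, -⟩ := AppearsWithin.cases_head hω.2
          refine Set.mem_iUnion.mpr ⟨B, ?_, hω.2⟩
          rw [← preHistory_inter]
          exact ⟨hω.1, hB⟩
      _ ≤ ∑ B : BadEvent n, P (history conf ev t p (Function.update b t (some B)) ∩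
            appearsFrom ev t (j + 1) τ) := measure_iUnion_fintype_le P _
      _ ≤ ∑ B : BadEvent n, P (history conf ev t p (Function.update b t (some B))) *
            ∑ q, levelProd eventMatrix D τ (p t) q :=
          Finset.sum_le_sum fun B _ => hrun.measure_history_inter_appearsFrom_succ_le ih t p _
            (Function.update_self _ _ _) τ D hD
      _ ≤ _ := by
          rw [← Finset.sum_mul]
          gcongr
          exact hrun.sum_measure_history_le t p b

theorem IsSwappingRun.measure_appears_le (hrun : IsSwappingRun 𝓑 P conf ev)
    (τ : WitnessTree (BadEvent n)) :
    P {ω | Appears τ fun t => ev t ω} ≤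
      (τ.labels.map fun B => ENNReal.ofReal (probOmega B)).prod := by
  have hU : {ω | Appears τ fun t => ev t ω} = ⋃ j, appearsFrom ev 0 j τ := by
    ext ω
    simp [appearsFrom, appears_iff_exists_appearsWithin]
  have hmono : Monotone fun j => appearsFrom ev 0 j τ := fun i j hij ω h => AppearsWithin.mono hij h
  rw [hU, hmono.measure_iUnion]
  refine iSup_le fun j => ?_
  have hpre : ∀ p : Config n,
      preHistory conf ev 0 (fun _ => p) (fun _ => none) = {ω | conf 0 ω = p} := fun p => by
    ext ω; simp [preHistory]
  calc P (appearsFrom ev 0 j τ)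
      ≤ ∑ p, P (appearsFrom ev 0 j τ ∩ {ω | conf 0 ω = p}) := measure_le_sum_inter _ _
    _ ≤ ∑ p, P {ω | conf 0 ω = p} * ∑ q, levelProd eventMatrix τ.labels.length τ p q := by
        refine Finset.sum_le_sum fun p _ => ?_
        rw [Set.inter_comm, ← hpre]
        exact hrun.appearanceBound j 0 _ _ τ _ fun e he => levelLabels_eq_nil τ e he
    _ = _ := by
        simp only [hrun.initial, PMF.uniformOfFintype_apply]
        -- The uniform weight is constant, so the sum over initial configurations can be taken
        -- inside as column sums; these do not depend on `q`, and the number of `q` cancels the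
        -- weight.
        rw [← Finset.mul_sum,
          Finset.sum_comm (f := fun p q => levelProd eventMatrix τ.labels.length τ p q)]
        simp only [sum_levelProd_eventMatrix, prod_levelLabels _ τ _ le_rfl]
        rw [Finset.sum_const, nsmul_eq_mul, ← mul_assoc, Finset.card_univ,
          ENNReal.inv_mul_cancel (Nat.cast_ne_zero.mpr Fintype.card_ne_zero) (ENNReal.natCast_ne_top _), one_mul]

end Run

end SwapLLL

theorem mainTheorem2 {N : ℕ} (n : Fin N → ℕ) (𝓑 : Set (SwapLLL.BadEvent n))
    {Ω : Type*} [MeasurableSpace Ω] (P : Measure Ω) [IsProbabilityMeasure P]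
    (conf : ℕ → Ω → SwapLLL.Config n) (ev : ℕ → Ω → Option (SwapLLL.BadEvent n))
    (hrun : SwapLLL.IsSwappingRun 𝓑 P conf ev)
    (τ : SwapLLL.WitnessTree (SwapLLL.BadEvent n)) :
    P.real {ω | SwapLLL.Appears τ (fun t => ev t ω)} ≤ (τ.labels.map SwapLLL.probOmega).prod ∧
    ∀ B : SwapLLL.BadEvent n, SwapLLL.Consistent B →
      SwapLLL.probOmega B =
        ∏ k, ((n k - SwapLLL.countAt B k).factorial : ℝ) / ((n k).factorial : ℝ) := by
  refine ⟨?_, fun B hB => SwapLLL.probOmega_of_consistent hB⟩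
  have h : ∀ L : List (SwapLLL.BadEvent n),
      (L.map fun B => ENNReal.ofReal (SwapLLL.probOmega B)).prod =
        ENNReal.ofReal (L.map SwapLLL.probOmega).prod := by
    intro L
    induction L with
    | nil => simp
    | cons B L ih =>
      rw [List.map_cons, List.prod_cons, ih, List.map_cons, List.prod_cons,
        ENNReal.ofReal_mul (SwapLLL.probOmega_nonneg B)]
  refine ENNReal.toReal_le_of_le_ofReal (List.prod_nonneg fun x hx => ?_)
    ((hrun.measure_appears_le τ).trans_eq (h _))
  obtain ⟨B, -, rfl⟩ := List.mem_map.mp hx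
  exact SwapLLL.probOmega_nonneg B
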